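/- Let $\mathbb F_q$ be the finite field with $q$ elements, where $q$ is a prime power divisible by neither $2$ nor $3$. Call an element $g$ of $SL_2(\mathbb F_q)$ a cube if $g=x^3$ for some $x\in SL_2(\mathbb F_q)$, and call a conjugacy class of $SL_2(\mathbb F_q)$ a cube if its elements are cubes. Let $c(3,q)$ be the number of conjugacy classes of $SL_2(\mathbb F_q)$ that are cubes, and let $s(3,q)$ be the number of elements of $SL_2(\mathbb F_q)$ that are cubes. Then: 1. $c(3,q)=\dfrac{2q+13}{3}$ if $3\mid q-1$, and $c(3,q)=\dfrac{2q+11}{3}$ if $3\mid q+1$. 2. The proportion of conjugacy classes of $SL_2(\mathbb F_q)$ that are cubes, i.e. $c(3,q)$ divided by the number of all conjugacy classes of $SL_2(\mathbb F_q)$, tends to $\dfrac23$ as $q\to\infty$ through prime powers divisible by neither $2$ nor $3$. 3. $s(3,q)=\dfrac{2q(q^2-1)}{3}$. 4. $\dfrac{s(3,q)}{|SL_2(\mathbb F_q)|}=\dfrac23$. -/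

import Mathlib

/-- The set of cubes `x ^ 3` of a group. -/
def cubeSet (G : Type*) [Group G] : Set G := {g | ∃ x : G, x ^ 3 = g}

/-- The set of conjugacy classes of a group that are cubes, that is, whose elements are all cubes
(equivalently, at least one element is a cube, the set of cubes being closed under conjugation). -/
def cubeClasses (G : Type*) [Group G] : Set (ConjClasses G) := {C | C.carrier ⊆ cubeSet G}

/-- Sanity check: a class is a cube as soon as one of its elements is. -/
theorem mk_mem_cubeClasses_iff {G : Type*} [Group G] (g : G) :
    ConjClasses.mk g ∈ cubeClasses G ↔ g ∈ cubeSet G := by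
  constructor
  · intro h
    exact h ConjClasses.mem_carrier_mk
  · rintro ⟨x, rfl⟩ a ha
    rw [ConjClasses.mem_carrier_iff_mk_eq, ConjClasses.mk_eq_mk_iff_isConj, isConj_comm,
      isConj_iff] at ha
    obtain ⟨c, rfl⟩ := ha
    exact ⟨c * x * c⁻¹, by simp [conj_pow]⟩

/-
The proof counts the elements and classes which are not cubes. By Cayley-Hamilton, a matrix of
determinant one and trace `s` has a cube of trace `T(s) = s ^ 3 - 3 * s`, and for `3 ≠ 0` an element
of `SL(2, F)` is a cube exactly when its trace is a value of `T`.

Write `χ` for the quadratic character of `F` and `ε = χ(-3)`, which is `1` if `3 ∣ q - 1` and `-1`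
if `3 ∣ q + 1`. Since `T(s) ^ 2 - 4 = (s ^ 2 - 1) ^ 2 * (s ^ 2 - 4)`, the map `T` essentially
preserves `χ(t ^ 2 - 4)`. It permutes the traces with `χ(t ^ 2 - 4) = -ε`, and apart from `s = ± 1`
it is three-to-one on those with `χ(t ^ 2 - 4) = ε`, so it misses exactly `(q - ε) / 3` traces,
all of the latter kind.

Each missed trace is that of `q ^ 2 + ε * q` elements, forming a single conjugacy class. This leaves
out `(q - ε) * (q ^ 2 + ε * q) / 3 = q * (q ^ 2 - 1) / 3` elements, a third of the group, and
`(q - ε) / 3` of the `q + 4` classes.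
-/

open Finset Matrix
open scoped MatrixGroups

section FiniteField

variable {F : Type*} [Field F]

theorem exists_sq_sub_mul_sq_eq [Finite F] (h2 : ringChar F ≠ 2) {δ : F} (hδ : δ ≠ 0) (k : F) :
    ∃ x y : F, x ^ 2 - δ * y ^ 2 = k := by
  have := Fintype.ofFinite F
  obtain ⟨x, y, h⟩ := FiniteField.exists_root_sum_quadratic
    (Polynomial.degree_quadratic (R := F) (b := 0) (c := -k) one_ne_zero)
    (Polynomial.degree_quadratic (b := 0) (c := 0) (neg_ne_zero.2 hδ))
    (FiniteField.odd_card_of_char_ne_two h2)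
  simp only [Polynomial.eval_add, Polynomial.eval_mul, Polynomial.eval_C, Polynomial.eval_pow,
    Polynomial.eval_X] at h
  exact ⟨x, y, by linear_combination h⟩

theorem natCast_ne_zero_of_prime_not_dvd_card [Finite F] {p : ℕ} (hp : p.Prime)
    (h : ¬ p ∣ Nat.card F) : (p : F) ≠ 0 := by
  have := Fintype.ofFinite F
  intro hp0
  have hchar : ringChar F = p :=
    ((hp.eq_one_or_self_of_dvd _ (ringChar.dvd hp0)).resolve_left CharP.ringChar_ne_one)
  have hcard : (Nat.card F : F) = 0 := by
    rw [Nat.card_eq_fintype_card, FiniteField.cast_card_eq_zero]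
  exact h (hchar ▸ ringChar.dvd hcard)

theorem ringChar_ne_two_of_not_two_dvd_card [Finite F] (h : ¬ 2 ∣ Nat.card F) :
    ringChar F ≠ 2 := fun hchar =>
  natCast_ne_zero_of_prime_not_dvd_card Nat.prime_two h (hchar ▸ ringChar.Nat.cast_ringChar)

theorem three_ne_zero_of_not_three_dvd_card [Finite F] (h : ¬ 3 ∣ Nat.card F) :
    (3 : F) ≠ 0 := by
  exact_mod_cast natCast_ne_zero_of_prime_not_dvd_card Nat.prime_three h

theorem quadraticChar_three_eq_one {q : ℕ} (hq : q ≠ 0) (h : 3 ∣ q - 1) :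
    quadraticChar (ZMod 3) q = 1 := by
  rw [(ZMod.natCast_eq_natCast_iff' q 1 3).2 (by lia), Nat.cast_one, map_one]

theorem quadraticChar_three_eq_neg_one {q : ℕ} (h : 3 ∣ q + 1) :
    quadraticChar (ZMod 3) q = -1 := by
  rw [(ZMod.natCast_eq_natCast_iff' q 2 3).2 (by lia)]
  decide

variable [Fintype F] [DecidableEq F]

theorem card_pairs_mul_eq (r : F) :
    (#{p : F × F | p.1 * p.2 = r} : ℤ) =
      Fintype.card F - 1 + if r = 0 then (Fintype.card F : ℤ) else 0 := by
  have hrow (a : F) : (#{b | a * b = r} : ℤ) =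
      if a = 0 then (if r = 0 then (Fintype.card F : ℤ) else 0) else 1 := by
    rcases eq_or_ne a 0 with rfl | ha
    · by_cases hr : r = 0 <;> simp [hr, eq_comm]
    · simp [ha, ← eq_inv_mul_iff_mul_eq₀ ha, filter_eq']
  calc (#{p : F × F | p.1 * p.2 = r} : ℤ) = ∑ a : F, (#{b | a * b = r} : ℤ) := by
        simp only [card_filter, Fintype.sum_prod_type, Nat.cast_sum]
    _ = _ := by
        simp [hrow, sum_ite, filter_eq', filter_ne', card_erase_of_mem,
          Nat.cast_sub Fintype.card_pos, add_comm]

theorem card_quadratic_roots (h2 : ringChar F ≠ 2) {a : F} (ha : a ≠ 0) (b c : F) :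
    (#{x : F | a * (x * x) + b * x + c = 0} : ℤ) = quadraticChar F (discrim a b c) + 1 := by
  have : NeZero (2 : F) := ⟨Ring.two_ne_zero h2⟩
  rw [← quadraticChar_card_sqrts h2]
  congr 1
  refine card_equiv
    ((Equiv.mulLeft₀ (2 * a) (mul_ne_zero two_ne_zero ha)).trans (Equiv.addRight b)) fun x => ?_
  simp [quadratic_eq_zero_iff_discrim_eq_sq ha, eq_comm]

theorem card_mul_sub_self_eq_one (h2 : ringChar F ≠ 2) (t : F) :
    (#{x : F | x * (t - x) = 1} : ℤ) = quadraticChar F (t ^ 2 - 4) + 1 := by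
  have hroot (x : F) : x * (t - x) = 1 ↔ 1 * (x * x) + -t * x + 1 = 0 := by
    constructor <;> intro h <;> linear_combination -h
  simp only [hroot]
  rw [card_quadratic_roots h2 one_ne_zero, discrim]
  ring_nf

theorem sum_quadraticChar_sq_sub_four (h2 : ringChar F ≠ 2) :
    ∑ t : F, quadraticChar F (t ^ 2 - 4) = -1 := by
  have hcol (x : F) : (#{t : F | x * (t - x) = 1} : ℤ) = if x = 0 then 0 else 1 := by
    rcases eq_or_ne x 0 with rfl | hx
    · simp
    · simp [hx, ← eq_inv_mul_iff_mul_eq₀ hx, sub_eq_iff_eq_add, filter_eq']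
  have hcount : ∑ t : F, (quadraticChar F (t ^ 2 - 4) + 1) = Fintype.card F - 1 := by
    simp only [← card_mul_sub_self_eq_one h2, ← Nat.cast_sum, card_filter]
    rw [sum_comm]
    simp only [← card_filter, Nat.cast_sum, hcol]
    simp [sum_ite, filter_ne', card_erase_of_mem, Nat.cast_sub Fintype.card_pos]
  rw [sum_add_distrib, sum_const, card_univ, nsmul_one] at hcount
  linarith

theorem quadraticChar_neg_three (h2 : ringChar F ≠ 2) (h3 : (3 : F) ≠ 0) :
    quadraticChar F (-3) = quadraticChar (ZMod 3) (Fintype.card F) := by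
  have hchar : ringChar F ≠ 3 := fun h => h3 (by exact_mod_cast h ▸ ringChar.Nat.cast_ringChar)
  rw [neg_eq_neg_one_mul, map_mul, ← Nat.cast_ofNat (n := 3),
    quadraticChar_odd_prime h2 (by decide) hchar, ← quadraticChar_neg_one h2]
  rcases quadraticChar_dichotomy (neg_ne_zero.2 (one_ne_zero (α := F))) with h | h
  · simp [h]
  · have hneg : quadraticChar (ZMod 3) (-1) = -1 := by decide
    rw [h, Int.cast_neg, Int.cast_one, neg_one_mul, neg_one_mul, neg_eq_neg_one_mul (_ : ZMod 3),
      map_mul, hneg, neg_one_mul, neg_neg]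

end FiniteField

section TraceCube

/-- The trace of `x ^ 3` in terms of the trace `s` of a `2 × 2` matrix `x` of determinant one. -/
def traceCube {R : Type*} [CommRing R] (s : R) : R := s ^ 3 - 3 * s

theorem traceCube_sq_sub_four {R : Type*} [CommRing R] (s : R) :
    traceCube s ^ 2 - 4 = (s ^ 2 - 1) ^ 2 * (s ^ 2 - 4) := by
  rw [traceCube]
  ring

theorem traceCube_eq_traceCube_iff {R : Type*} [CommRing R] [NoZeroDivisors R] {r s : R} :
    traceCube r = traceCube s ↔ r = s ∨ 1 * (r * r) + s * r + (s ^ 2 - 3) = 0 := by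
  rw [← sub_eq_zero, show traceCube r - traceCube s =
    (r - s) * (1 * (r * r) + s * r + (s ^ 2 - 3)) by simp only [traceCube]; ring,
    mul_eq_zero, sub_eq_zero]

theorem exists_traceCube_eq_of_sq_eq_four {R : Type*} [CommRing R] [NoZeroDivisors R] {t : R}
    (ht : t ^ 2 = 4) : ∃ s, traceCube s = t :=
  ⟨t, by rw [traceCube]; linear_combination t * ht⟩

variable {F : Type*} [Field F] [Fintype F] [DecidableEq F]

variable (F) in
/-- The traces `t` for which the discriminant `t ^ 2 - 4` of `X ^ 2 - t * X + 1` has quadratic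
character `e`: the matrices with such a trace have eigenvalues in `F` if `e = 1`, and outside `F`
if `e = -1`. -/
def tracesOfType (e : ℤ) : Finset F := {t | quadraticChar F (t ^ 2 - 4) = e}

theorem mem_tracesOfType {e : ℤ} {t : F} :
    t ∈ tracesOfType F e ↔ quadraticChar F (t ^ 2 - 4) = e := by
  simp [tracesOfType]

variable (F) in
/-- The traces which are not the trace of a cube of `SL(2, F)`. -/
def noncubeTraces : Finset F := {t | ∀ s, traceCube s ≠ t}

theorem mem_noncubeTraces {t : F} : t ∈ noncubeTraces F ↔ ∀ s, traceCube s ≠ t := by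
  simp [noncubeTraces]

theorem card_sq_eq_sq (h2 : ringChar F ≠ 2) {a : F} (ha : a ≠ 0) :
    #{x : F | x ^ 2 = a ^ 2} = 2 := by
  have hne : a ≠ -a := fun h => ha ((Ring.eq_self_iff_eq_zero_of_char_ne_two h2).1 h.symm)
  have hroots : ({x : F | x ^ 2 = a ^ 2} : Finset F) = {a, -a} := by
    ext x
    simp [sq_eq_sq_iff_eq_or_eq_neg]
  rw [hroots, card_pair hne]

theorem card_sq_eq_four (h2 : ringChar F ≠ 2) : #{t : F | t ^ 2 = 4} = 2 := by
  rw [show (4 : F) = 2 ^ 2 by norm_num, card_sq_eq_sq h2 (Ring.two_ne_zero h2)]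

theorem two_mul_card_tracesOfType (h2 : ringChar F ≠ 2) {e : ℤ} (he : e = 1 ∨ e = -1) :
    2 * (#(tracesOfType F e) : ℤ) = Fintype.card F - 2 - e := by
  have hind (t : F) : 2 * (if quadraticChar F (t ^ 2 - 4) = e then 1 else 0 : ℤ) =
      1 - (if t ^ 2 = 4 then 1 else 0) + e * quadraticChar F (t ^ 2 - 4) := by
    rcases eq_or_ne (t ^ 2) 4 with ht | ht
    · rcases he with rfl | rfl <;> simp [ht]
    · rcases quadraticChar_dichotomy (sub_ne_zero.2 ht) with h | h <;>
        rcases he with rfl | rfl <;> simp [ht, h]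
  calc 2 * (#(tracesOfType F e) : ℤ)
      = ∑ t : F, 2 * (if quadraticChar F (t ^ 2 - 4) = e then 1 else 0 : ℤ) := by
        rw [tracesOfType, card_filter, ← mul_sum]
        norm_cast
    _ = Fintype.card F - 2 + e * -1 := by
        simp only [hind, sum_add_distrib, sum_sub_distrib, ← mul_sum,
          sum_quadraticChar_sq_sub_four h2, sum_boole, card_sq_eq_four h2]
        simp
    _ = Fintype.card F - 2 - e := by ring

theorem quadraticChar_traceCube_sq_sub_four {s : F} (hs : s ^ 2 ≠ 1) :
    quadraticChar F (traceCube s ^ 2 - 4) = quadraticChar F (s ^ 2 - 4) := by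
  rw [traceCube_sq_sub_four, map_mul, quadraticChar_sq_one' (sub_ne_zero.2 hs), one_mul]

theorem traceCube_mem_tracesOfType_iff {e : ℤ} (he : e ≠ 0) {s : F} :
    traceCube s ∈ tracesOfType F e ↔ s ∈ tracesOfType F e ∧ s ^ 2 ≠ 1 := by
  rw [mem_tracesOfType, mem_tracesOfType]
  rcases eq_or_ne (s ^ 2) 1 with hs | hs
  · simp [traceCube_sq_sub_four, hs, he.symm]
  · simp [quadraticChar_traceCube_sq_sub_four hs, hs]

/-- The other preimages of `traceCube s` are the roots of a quadratic of discriminant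
`-3 * (s ^ 2 - 4)`. -/
theorem card_traceCube_fiber (h2 : ringChar F ≠ 2) (h3 : (3 : F) ≠ 0) {s : F} (hs : s ^ 2 ≠ 1) :
    (#{r | traceCube r = traceCube s} : ℤ) =
      2 + quadraticChar F (-3) * quadraticChar F (s ^ 2 - 4) := by
  have hfiber : ({r | traceCube r = traceCube s} : Finset F) =
      insert s ({r | 1 * (r * r) + s * r + (s ^ 2 - 3) = 0} : Finset F) := by
    ext r
    simp [traceCube_eq_traceCube_iff]
  have hsmem : s ∉ ({r | 1 * (r * r) + s * r + (s ^ 2 - 3) = 0} : Finset F) := by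
    simp only [mem_filter_univ]
    intro h
    have : (3 : F) * (s ^ 2 - 1) = 0 := by linear_combination h
    exact hs (sub_eq_zero.1 ((mul_eq_zero.1 this).resolve_left h3))
  rw [hfiber, card_insert_of_notMem hsmem, Nat.cast_add, card_quadratic_roots h2 one_ne_zero,
    discrim, ← map_mul, show s ^ 2 - 4 * 1 * (s ^ 2 - 3) = -3 * (s ^ 2 - 4) by ring]
  push_cast
  ring

theorem sq_ne_one_of_mem_tracesOfType {e : ℤ} (he : e ≠ quadraticChar F (-3)) {s : F}
    (hs : s ∈ tracesOfType F e) : s ^ 2 ≠ 1 := fun h => he <| by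
  rw [← mem_tracesOfType.1 hs, h, show (1 : F) - 4 = -3 by norm_num]

/-- `traceCube` permutes the traces of type `-quadraticChar F (-3)`. -/
theorem exists_traceCube_eq_of_mem_tracesOfType (h2 : ringChar F ≠ 2) (h3 : (3 : F) ≠ 0) {t : F}
    (ht : t ∈ tracesOfType F (-quadraticChar F (-3))) : ∃ s, traceCube s = t := by
  set ε := quadraticChar F (-3)
  have hε : ε = 1 ∨ ε = -1 := quadraticChar_dichotomy (neg_ne_zero.2 h3)
  have hone {s : F} : s ∈ tracesOfType F (-ε) → s ^ 2 ≠ 1 :=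
    sq_ne_one_of_mem_tracesOfType (by lia)
  have hmaps : Set.MapsTo traceCube (tracesOfType F (-ε)) (tracesOfType F (-ε) : Set F) :=
    fun s hs => (traceCube_mem_tracesOfType_iff (by lia)).2 ⟨hs, hone hs⟩
  have hinj : Set.InjOn traceCube (tracesOfType F (-ε) : Set F) := by
    intro r _ s hs hrs
    have hfiber : #{r | traceCube r = traceCube s} ≤ 1 := by
      have hcard := card_traceCube_fiber h2 h3 (hone hs)
      rw [mem_tracesOfType.1 hs] at hcard
      rcases hε with h | h <;> simp only [ε, h] at hcard <;> lia
    exact card_le_one.1 hfiber r (by simpa) s (by simp)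
  obtain ⟨s, -, hs⟩ := surjOn_of_injOn_of_card_le traceCube hmaps hinj le_rfl ht
  exact ⟨s, hs⟩

theorem noncubeTraces_subset_tracesOfType (h2 : ringChar F ≠ 2) (h3 : (3 : F) ≠ 0) :
    noncubeTraces F ⊆ tracesOfType F (quadraticChar F (-3)) := by
  intro t ht
  rw [mem_noncubeTraces, ← not_exists] at ht
  have hdisc : t ^ 2 - 4 ≠ 0 := fun h =>
    ht (exists_traceCube_eq_of_sq_eq_four (sub_eq_zero.1 h))
  have hneg : quadraticChar F (t ^ 2 - 4) ≠ -quadraticChar F (-3) := fun h =>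
    ht (exists_traceCube_eq_of_mem_tracesOfType h2 h3 (mem_tracesOfType.2 h))
  rw [mem_tracesOfType]
  have := quadraticChar_dichotomy hdisc
  have := quadraticChar_dichotomy (neg_ne_zero.2 h3)
  lia

theorem card_tracesOfType_filter_sq_ne_one (h2 : ringChar F ≠ 2) :
    #{s ∈ tracesOfType F (quadraticChar F (-3)) | s ^ 2 ≠ 1} + 2 =
      #(tracesOfType F (quadraticChar F (-3))) := by
  have hroots : {s ∈ tracesOfType F (quadraticChar F (-3)) | s ^ 2 = 1} =
      ({s : F | s ^ 2 = 1 ^ 2} : Finset F) := by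
    ext s
    simp only [mem_filter, mem_tracesOfType, mem_univ, true_and, one_pow, and_iff_right_iff_imp]
    intro hs
    rw [hs, show (1 : F) - 4 = -3 by norm_num]
  have htwo := card_sq_eq_sq h2 (one_ne_zero (α := F))
  have hsplit := card_filter_add_card_filter_not (s := tracesOfType F (quadraticChar F (-3)))
    (fun s => s ^ 2 = 1)
  rw [hroots, htwo] at hsplit
  lia

theorem card_traceCube_fiber_of_mem_tracesOfType (h2 : ringChar F ≠ 2) (h3 : (3 : F) ≠ 0) {s : F}
    (hs : s ∈ tracesOfType F (quadraticChar F (-3))) (hs1 : s ^ 2 ≠ 1) :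
    #{r | traceCube r = traceCube s} = 3 := by
  have hcard := card_traceCube_fiber h2 h3 hs1
  rw [mem_tracesOfType.1 hs, ← sq, quadraticChar_sq_one (neg_ne_zero.2 h3)] at hcard
  exact_mod_cast hcard

theorem three_mul_card_noncubeTraces (h2 : ringChar F ≠ 2) (h3 : (3 : F) ≠ 0) :
    3 * (#(noncubeTraces F) : ℤ) = Fintype.card F - quadraticChar F (-3) := by
  have hε := quadraticChar_dichotomy (neg_ne_zero.2 h3)
  set ε := quadraticChar F (-3)
  set S : Finset F := {s ∈ tracesOfType F ε | s ^ 2 ≠ 1} with hS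
  have hmem (s : F) : traceCube s ∈ tracesOfType F ε ↔ s ∈ S := by
    rw [traceCube_mem_tracesOfType_iff (by lia), hS, mem_filter]
  have himage : tracesOfType F ε \ noncubeTraces F = S.image traceCube := by
    ext t
    simp only [mem_sdiff, mem_noncubeTraces, mem_image, ne_eq, not_forall, not_not]
    constructor
    · rintro ⟨ht, s, rfl⟩
      exact ⟨s, (hmem s).1 ht, rfl⟩
    · rintro ⟨s, hs, rfl⟩
      exact ⟨(hmem s).2 hs, s, rfl⟩
  have hfiber : ∀ t ∈ S.image traceCube, #{s ∈ S | traceCube s = t} = 3 := by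
    simp only [forall_mem_image]
    intro s hs
    rw [← card_traceCube_fiber_of_mem_tracesOfType h2 h3 (mem_filter.1 hs).1 (mem_filter.1 hs).2]
    congr 1
    ext r
    simp only [mem_filter, mem_univ, true_and, and_iff_right_iff_imp]
    intro hr
    rwa [← hmem, hr, hmem]
  have hcard : #S = #(S.image traceCube) * 3 := by
    rw [card_eq_sum_card_image traceCube S, sum_const_nat hfiber]
  have hsplit := card_sdiff_add_card_eq_card (noncubeTraces_subset_tracesOfType h2 h3)
  have hS2 : #S + 2 = #(tracesOfType F ε) := card_tracesOfType_filter_sq_ne_one h2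
  have htype := two_mul_card_tracesOfType h2 hε
  rw [himage] at hsplit
  lia

end TraceCube

section SL2Trace

theorem cube_eq_of_det_eq_one {R : Type*} [CommRing R] {M : Matrix (Fin 2) (Fin 2) R}
    (h : M.det = 1) : M ^ 3 = (M.trace ^ 2 - 1) • M - M.trace • 1 := by
  have hsq : M ^ 2 = M.trace • M - 1 := by
    nontriviality R
    have hCH := M.aeval_self_charpoly
    simp only [charpoly_fin_two, h, map_one, map_add, map_sub, map_mul, map_pow,
      Polynomial.aeval_X, Polynomial.aeval_C, Algebra.algebraMap_eq_smul_one, smul_mul_assoc,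
      one_mul] at hCH
    rw [← sub_eq_zero, ← hCH]
    abel
  rw [pow_succ, hsq, sub_mul, smul_mul_assoc, ← sq, hsq, one_mul, smul_sub, smul_smul, sub_smul,
    one_smul, sq]
  abel

theorem trace_cube_of_det_eq_one {R : Type*} [CommRing R] {M : Matrix (Fin 2) (Fin 2) R}
    (h : M.det = 1) : (M ^ 3).trace = traceCube M.trace := by
  rw [cube_eq_of_det_eq_one h, traceCube, trace_sub, trace_smul, trace_smul, trace_one,
    Fintype.card_fin, smul_eq_mul, smul_eq_mul]
  push_cast
  ring

theorem SL2_det_eq {R : Type*} [CommRing R] (g : SL(2, R)) :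
    g.1 0 0 * g.1 1 1 - g.1 0 1 * g.1 1 0 = 1 := by
  rw [← det_fin_two, g.2]

section Field

variable {F : Type*} [Field F]

theorem exists_traceCube_eq_of_sq_ne_one (h3 : (3 : F) ≠ 0) {t : F} (ht : ∃ s, traceCube s = t) :
    ∃ s, s ^ 2 ≠ 1 ∧ traceCube s = t := by
  obtain ⟨s, rfl⟩ := ht
  by_cases hs : s ^ 2 = 1
  · refine ⟨-2 * s, fun h => h3 (by linear_combination h - 4 * hs), ?_⟩
    simp only [traceCube]
    linear_combination (-9 * s) * hs
  · exact ⟨s, hs, rfl⟩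

/-- By `cube_eq_of_det_eq_one`, a cube root of `g` of trace `s` can only be
`(s ^ 2 - 1)⁻¹ • (g + s • 1)`. -/
theorem exists_cube_eq_of_trace_eq_traceCube {g : SL(2, F)} {s : F} (hs : s ^ 2 ≠ 1)
    (hg : g.1.trace = traceCube s) : ∃ x : SL(2, F), x ^ 3 = g := by
  have hs' : s ^ 2 - 1 ≠ 0 := sub_ne_zero.2 hs
  have hdet := SL2_det_eq g
  rw [trace_fin_two, traceCube] at hg
  set M : Matrix (Fin 2) (Fin 2) F := (s ^ 2 - 1)⁻¹ • (g.1 + s • 1) with hM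
  have htrace : M.trace = s := by
    simp only [hM, trace_smul, trace_add, trace_fin_two, one_apply_eq, smul_eq_mul]
    field_simp
    linear_combination hg
  have hMdet : M.det = 1 := by
    simp only [hM, det_smul, det_fin_two, Fintype.card_fin, Matrix.add_apply, Matrix.smul_apply,
      smul_eq_mul, one_apply_eq, one_apply_ne zero_ne_one, one_apply_ne one_ne_zero]
    field_simp
    linear_combination hdet + s * hg
  let x : SL(2, F) := ⟨M, hMdet⟩
  refine ⟨x, Subtype.ext ?_⟩
  calc (x ^ 3).1 = M ^ 3 := Matrix.SpecialLinearGroup.coe_pow x 3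
    _ = g.1 := by
      rw [cube_eq_of_det_eq_one hMdet, htrace, hM, smul_smul, mul_inv_cancel₀ hs', one_smul,
        add_sub_cancel_right]

theorem mem_cubeSet_iff_trace (h3 : (3 : F) ≠ 0) {g : SL(2, F)} :
    g ∈ cubeSet SL(2, F) ↔ ∃ s, traceCube s = g.1.trace := by
  constructor
  · rintro ⟨x, rfl⟩
    exact ⟨x.1.trace, by rw [Matrix.SpecialLinearGroup.coe_pow, trace_cube_of_det_eq_one x.2]⟩
  · intro h
    obtain ⟨s, hs, hg⟩ := exists_traceCube_eq_of_sq_ne_one h3 h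
    exact exists_cube_eq_of_trace_eq_traceCube hs hg.symm

/-- A matrix of trace `t` is determined by its entries except the last one. -/
def SL2TraceEquiv (t : F) :
    {g : SL(2, F) // g.1.trace = t} ≃ {p : F × F × F // p.2.1 * p.2.2 = p.1 * (t - p.1) - 1} where
  toFun g := ⟨(g.1.1 0 0, g.1.1 0 1, g.1.1 1 0), by
    have ht := g.2
    rw [trace_fin_two] at ht
    linear_combination -SL2_det_eq g.1 + g.1.1 0 0 * ht⟩
  invFun p := ⟨⟨!![p.1.1, p.1.2.1; p.1.2.2, t - p.1.1], by
    rw [det_fin_two_of]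
    linear_combination -p.2⟩, by simp [trace_fin_two]⟩
  left_inv g := by
    have ht := g.2
    rw [trace_fin_two] at ht
    ext i j
    fin_cases i <;> fin_cases j <;> simp [← ht]
  right_inv p := by simp

end Field

variable {F : Type*} [Field F]

theorem natCard_SL2_trace_eq [Fintype F] [DecidableEq F] (h2 : ringChar F ≠ 2) (t : F) :
    (Nat.card {g : SL(2, F) // g.1.trace = t} : ℤ) =
      (Fintype.card F : ℤ) ^ 2 + Fintype.card F * quadraticChar F (t ^ 2 - 4) := by
  have hslice (a : F) : (#{p : F × F | p.1 * p.2 = a * (t - a) - 1} : ℤ) =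
      Fintype.card F - 1 + if a * (t - a) = 1 then (Fintype.card F : ℤ) else 0 := by
    simp only [card_pairs_mul_eq, sub_eq_zero]
  rw [Nat.card_congr (SL2TraceEquiv t), Nat.card_eq_fintype_card, Fintype.card_subtype,
    card_filter, Fintype.sum_prod_type]
  simp only [← card_filter]
  rw [Nat.cast_sum, sum_congr rfl fun a _ => hslice a, sum_add_distrib, sum_const, card_univ,
    nsmul_eq_mul, ← sum_filter, sum_const, nsmul_eq_mul, card_mul_sub_self_eq_one h2]
  ring

theorem natCard_SL2 [Finite F] (h2 : ringChar F ≠ 2) :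
    (Nat.card SL(2, F) : ℤ) = Nat.card F * ((Nat.card F : ℤ) ^ 2 - 1) := by
  classical
  have := Fintype.ofFinite F
  rw [Nat.card_eq_fintype_card (α := F)]
  have hfibers := card_preimage_eq_sum_card_image_eq (f := fun g : SL(2, F) => g.1.trace)
    (s := univ) fun _ _ => Set.toFinite _
  rw [coe_univ, Set.preimage_univ, Nat.card_univ] at hfibers
  rw [hfibers, Nat.cast_sum]
  simp only [natCard_SL2_trace_eq h2, sum_add_distrib, ← mul_sum, sum_quadraticChar_sq_sub_four h2,
    sum_const, card_univ, nsmul_eq_mul]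
  ring

theorem compl_cubeSet_SL2 [Fintype F] [DecidableEq F] (h3 : (3 : F) ≠ 0) :
    (cubeSet SL(2, F))ᶜ = (fun g : SL(2, F) => g.1.trace) ⁻¹' noncubeTraces F := by
  ext g
  rw [Set.mem_compl_iff, mem_cubeSet_iff_trace h3, Set.mem_preimage, mem_coe, mem_noncubeTraces,
    not_exists]

theorem three_mul_ncard_cubeSet_SL2 [Finite F] (h2 : ringChar F ≠ 2) (h3 : (3 : F) ≠ 0) :
    3 * (cubeSet SL(2, F)).ncard = 2 * Nat.card SL(2, F) := by
  classical
  have := Fintype.ofFinite F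
  have hnoncubes : ((cubeSet SL(2, F))ᶜ.ncard : ℤ) = #(noncubeTraces F) *
      ((Fintype.card F : ℤ) ^ 2 + Fintype.card F * quadraticChar F (-3)) := by
    rw [compl_cubeSet_SL2 h3, ← Nat.card_coe_set_eq,
      card_preimage_eq_sum_card_image_eq fun _ _ => Set.toFinite _, Nat.cast_sum,
      sum_congr rfl fun t ht => ?_, sum_const, nsmul_eq_mul]
    rw [natCard_SL2_trace_eq h2,
      mem_tracesOfType.1 (noncubeTraces_subset_tracesOfType h2 h3 ht)]
  have hsplit := Set.ncard_add_ncard_compl (cubeSet SL(2, F))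
  have hG := natCard_SL2 h2
  rw [Nat.card_eq_fintype_card (α := F)] at hG
  have hN := three_mul_card_noncubeTraces h2 h3
  have hε := quadraticChar_sq_one (neg_ne_zero.2 h3)
  zify at hsplit ⊢
  linear_combination 3 * hsplit - 3 * hnoncubes + hG - (Fintype.card F ^ 2 +
    Fintype.card F * quadraticChar F (-3)) * hN + Fintype.card F * hε

end SL2Trace

section Companion

variable {R : Type*} [CommRing R]

theorem trace_eq_of_isConj {g h : SL(2, R)} (hgh : IsConj g h) : g.1.trace = h.1.trace := by
  obtain ⟨P, hP⟩ := isConj_iff.1 hgh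
  let Q : SL(2, R) := P⁻¹
  have hQP : Q.1 * P.1 = 1 :=
    congrArg (fun x : SL(2, R) => x.1) (inv_mul_cancel P)
  calc g.1.trace = (Q.1 * (P.1 * g.1)).trace := by
        rw [← Matrix.mul_assoc, hQP, Matrix.one_mul]
    _ = (P.1 * g.1 * Q.1).trace := trace_mul_comm _ _
    _ = h.1.trace := congrArg (fun x : SL(2, R) => x.1.trace) hP

/-- The determinant of the matrix with columns `v = (x, y)` and `g v`. As a binary quadratic form
in `x` and `y` it has discriminant `g.1.trace ^ 2 - 4`, and its values tell apart the conjugacy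
classes of a given trace. -/
def cyclicForm (g : SL(2, R)) (x y : R) : R :=
  g.1 1 0 * x ^ 2 + (g.1 1 1 - g.1 0 0) * x * y - g.1 0 1 * y ^ 2

/-- The matrix of `g` in the basis `v`, `k⁻¹ • g v`, for any `g` of trace `t` and any `v` on which
`cyclicForm g` takes the value `k`. -/
def companionSL (t : R) (k : Rˣ) : SL(2, R) :=
  ⟨!![0, -↑k⁻¹; ↑k, t], by simp [det_fin_two_of]⟩

theorem trace_companionSL (t : R) (k : Rˣ) : (companionSL t k).1.trace = t := by
  simp [companionSL, trace_fin_two]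

theorem cyclicForm_companionSL (t : R) (k : Rˣ) (x y : R) :
    cyclicForm (companionSL t k) x y = k * x ^ 2 + t * x * y + ↑k⁻¹ * y ^ 2 := by
  simp [cyclicForm, companionSL]

theorem exists_cyclicForm_eq_of_isConj_companionSL {t : R} {k : Rˣ} {g : SL(2, R)}
    (h : IsConj (companionSL t k) g) : ∃ x y, cyclicForm g x y = k := by
  obtain ⟨P, hP⟩ := isConj_iff.1 h
  have hPg : P.1 * (companionSL t k).1 = g.1 * P.1 :=
    congrArg (fun x : SL(2, R) => x.1) (mul_inv_eq_iff_eq_mul.1 hP)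
  have htop := congrFun₂ hPg 0 0
  have hbot := congrFun₂ hPg 1 0
  simp only [companionSL, mul_apply, Fin.sum_univ_two, of_apply, cons_val_zero, cons_val_one,
    mul_zero, zero_add] at htop hbot
  refine ⟨P.1 0 0, P.1 1 0, ?_⟩
  rw [cyclicForm]
  linear_combination k * SL2_det_eq P - P.1 0 0 * hbot + P.1 1 0 * htop

theorem isConj_companionSL_of_cyclicForm_eq {k : Rˣ} {g : SL(2, R)} {x y : R}
    (h : cyclicForm g x y = k) : IsConj (companionSL g.1.trace k) g := by
  have hg := SL2_det_eq g
  have hk : (k : R) * ↑k⁻¹ = 1 := k.mul_inv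
  let P : SL(2, R) := ⟨!![x, ↑k⁻¹ * (g.1 0 0 * x + g.1 0 1 * y);
    y, ↑k⁻¹ * (g.1 1 0 * x + g.1 1 1 * y)], by
      rw [cyclicForm] at h
      rw [det_fin_two_of]
      linear_combination ↑k⁻¹ * h + hk⟩
  have hP : P.1 * (companionSL g.1.trace k).1 = g.1 * P.1 := by
    ext i j
    fin_cases i <;> fin_cases j <;>
      simp [P, companionSL, mul_apply, Fin.sum_univ_two, trace_fin_two]
    · linear_combination (g.1 0 0 * x + g.1 0 1 * y) * hk
    · linear_combination ↑k⁻¹ * x * hg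
    · linear_combination (g.1 1 0 * x + g.1 1 1 * y) * hk
    · linear_combination ↑k⁻¹ * y * hg
  exact isConj_iff.2 ⟨P, mul_inv_eq_iff_eq_mul.2 (Subtype.ext hP)⟩

theorem isConj_companionSL_companionSL_iff {t : R} {k l : Rˣ} :
    IsConj (companionSL t k) (companionSL t l) ↔
      ∃ x y, (l : R) * x ^ 2 + t * x * y + ↑l⁻¹ * y ^ 2 = k := by
  simp only [← cyclicForm_companionSL]
  refine ⟨exists_cyclicForm_eq_of_isConj_companionSL, fun ⟨x, y, h⟩ => ?_⟩
  have := isConj_companionSL_of_cyclicForm_eq h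
  rwa [trace_companionSL] at this

/-- Here the form is `l⁻¹ * (l * x + e * y) ^ 2`. -/
theorem isConj_companionSL_two_mul_iff_isSquare {e : R} (he : e ^ 2 = 1) {k l : Rˣ} :
    IsConj (companionSL (2 * e) k) (companionSL (2 * e) l) ↔ IsSquare ((k : R) * l) := by
  have hl : (l : R) * ↑l⁻¹ = 1 := l.mul_inv
  rw [isConj_companionSL_companionSL_iff]
  constructor
  · rintro ⟨x, y, h⟩
    refine ⟨l * x + e * y, ?_⟩
    linear_combination -l * h + y ^ 2 * hl - y ^ 2 * he
  · rintro ⟨z, hz⟩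
    refine ⟨↑l⁻¹ * z, 0, ?_⟩
    linear_combination (↑l⁻¹ * z ^ 2 + k) * hl - ↑l⁻¹ * hz

theorem mem_center_SL2_iff {g : SL(2, R)} :
    g ∈ Subgroup.center SL(2, R) ↔ g.1 0 1 = 0 ∧ g.1 1 0 = 0 ∧ g.1 0 0 = g.1 1 1 := by
  constructor
  · intro hg
    have hscalar := Matrix.SpecialLinearGroup.scalar_eq_self_of_mem_center hg 0
    refine ⟨?_, ?_, ?_⟩ <;> rw [← hscalar] <;> simp
  · rintro ⟨h01, h10, h00⟩
    have hdet := SL2_det_eq g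
    refine Matrix.SpecialLinearGroup.mem_center_iff.2 ⟨g.1 0 0, ?_, ?_⟩
    · rw [Fintype.card_fin]
      linear_combination hdet + g.1 0 0 * h00 + g.1 1 0 * h01
    · ext i j
      fin_cases i <;> fin_cases j <;> simp [h01, h10, h00]

theorem companionSL_notMem_center [Nontrivial R] (t : R) (k : Rˣ) :
    companionSL t k ∉ Subgroup.center SL(2, R) :=
  fun h => k.ne_zero (mem_center_SL2_iff.1 h).2.1

theorem sq_trace_of_mem_center {g : SL(2, R)} (hg : g ∈ Subgroup.center SL(2, R)) :
    g.1.trace ^ 2 = 4 := by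
  obtain ⟨h01, -, h00⟩ := mem_center_SL2_iff.1 hg
  rw [trace_fin_two]
  linear_combination 4 * SL2_det_eq g + 4 * g.1 1 0 * h01 + (g.1 0 0 - g.1 1 1) * h00

theorem exists_mem_center_trace_eq {e : R} (he : e ^ 2 = 1) :
    ∃ z ∈ Subgroup.center SL(2, R), z.1.trace = 2 * e := by
  let z : SL(2, R) := ⟨!![e, 0; 0, e], by rw [det_fin_two_of]; linear_combination he⟩
  refine ⟨z, mem_center_SL2_iff.2 ⟨rfl, rfl, rfl⟩, ?_⟩
  rw [trace_fin_two]
  exact (two_mul e).symm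

theorem eq_of_mem_center_of_trace_eq [NoZeroDivisors R] (h2 : (2 : R) ≠ 0) {g h : SL(2, R)}
    (hg : g ∈ Subgroup.center SL(2, R)) (hh : h ∈ Subgroup.center SL(2, R))
    (htrace : g.1.trace = h.1.trace) : g = h := by
  obtain ⟨hg01, hg10, hg00⟩ := mem_center_SL2_iff.1 hg
  obtain ⟨hh01, hh10, hh00⟩ := mem_center_SL2_iff.1 hh
  rw [trace_fin_two, trace_fin_two, ← hg00, ← hh00, ← two_mul, ← two_mul] at htrace
  have hdiag : g.1 0 0 = h.1 0 0 := mul_left_cancel₀ h2 htrace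
  apply Subtype.ext
  rw [eta_fin_two g.1, eta_fin_two h.1, hg01, hg10, ← hg00, hh01, hh10, ← hh00, hdiag]

variable {F : Type*} [Field F]

theorem exists_isConj_companionSL {g : SL(2, F)} (hg : g ∉ Subgroup.center SL(2, F)) :
    ∃ k : Fˣ, IsConj (companionSL g.1.trace k) g := by
  obtain ⟨x, y, hxy⟩ : ∃ x y, cyclicForm g x y ≠ 0 := by
    contrapose! hg
    have hx := hg 1 0
    have hy := hg 0 1
    have hdiag := hg 1 1
    simp only [cyclicForm] at hx hy hdiag
    exact mem_center_SL2_iff.2 ⟨by linear_combination -hy, by linear_combination hx,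
      by linear_combination hx + hy - hdiag⟩
  exact ⟨Units.mk0 _ hxy, isConj_companionSL_of_cyclicForm_eq (Units.val_mk0 hxy).symm⟩

theorem isConj_companionSL_of_sq_ne_four [Finite F] (h2 : ringChar F ≠ 2) {t : F} (ht : t ^ 2 ≠ 4)
    (k l : Fˣ) : IsConj (companionSL t k) (companionSL t l) := by
  have h2' : (2 : F) ≠ 0 := Ring.two_ne_zero h2
  have hδ : (t / 2) ^ 2 - 1 ≠ 0 := by
    intro h
    field_simp at h
    exact ht (by linear_combination h)
  obtain ⟨x, y, hxy⟩ := exists_sq_sub_mul_sq_eq h2 hδ (k * l)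
  refine isConj_companionSL_companionSL_iff.2 ⟨(x - t / 2 * y) / l, y, ?_⟩
  rw [Units.val_inv_eq_inv_val]
  field_simp at hxy ⊢
  linear_combination hxy

end Companion

section Classes

/-- The trace of the elements of a conjugacy class. -/
def classTrace {R : Type*} [CommRing R] : ConjClasses SL(2, R) → R :=
  Quotient.lift (fun g => g.1.trace) fun _ _ => trace_eq_of_isConj

theorem classTrace_mk {R : Type*} [CommRing R] (g : SL(2, R)) :
    classTrace (ConjClasses.mk g) = g.1.trace := rfl

variable {F : Type*} [Field F]

theorem isSquare_mul_of_not_isSquare [Finite F] {a b : F} (ha : ¬ IsSquare a)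
    (hb : ¬ IsSquare b) : IsSquare (a * b) := by
  classical
  have := Fintype.ofFinite F
  have hab : a * b ≠ 0 := mul_ne_zero (fun h => ha (h ▸ IsSquare.zero))
    fun h => hb (h ▸ IsSquare.zero)
  rw [← quadraticChar_one_iff_isSquare hab, map_mul, quadraticChar_neg_one_iff_not_isSquare.2 ha,
    quadraticChar_neg_one_iff_not_isSquare.2 hb, neg_one_mul, neg_neg]

theorem ncard_classTrace_preimage_of_sq_ne_four [Finite F] (h2 : ringChar F ≠ 2) {t : F}
    (ht : t ^ 2 ≠ 4) : (classTrace ⁻¹' {t}).ncard = 1 := by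
  refine Set.ncard_eq_one.2 ⟨ConjClasses.mk (companionSL t 1),
    Set.Subset.antisymm (fun C hC => ?_) ?_⟩
  · obtain ⟨g, rfl⟩ := ConjClasses.mk_surjective C
    rw [Set.mem_preimage, Set.mem_singleton_iff, classTrace_mk] at hC
    have hg : g ∉ Subgroup.center SL(2, F) := fun h => ht (hC ▸ sq_trace_of_mem_center h)
    obtain ⟨k, hk⟩ := exists_isConj_companionSL hg
    rw [hC] at hk
    exact ConjClasses.mk_eq_mk_iff_isConj.2
      (hk.symm.trans (isConj_companionSL_of_sq_ne_four h2 ht k 1))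
  · exact Set.singleton_subset_iff.2 (trace_companionSL t 1)

theorem isConj_companionSL_one_or_of_not_isSquare [Finite F] {e : F} (he : e ^ 2 = 1) {r : Fˣ}
    (hr : ¬ IsSquare (r : F)) (k : Fˣ) :
    IsConj (companionSL (2 * e) k) (companionSL (2 * e) 1) ∨
      IsConj (companionSL (2 * e) k) (companionSL (2 * e) r) := by
  simp only [isConj_companionSL_two_mul_iff_isSquare he, Units.val_one, mul_one]
  exact or_iff_not_imp_left.2 fun hk => isSquare_mul_of_not_isSquare hk hr

/-- These are the class of a scalar matrix and two classes of matrices `companionSL t k`, told apart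
by whether `k` is a square. -/
theorem ncard_classTrace_preimage_of_sq_eq_four [Finite F] (h2 : ringChar F ≠ 2) {t : F}
    (ht : t ^ 2 = 4) : (classTrace ⁻¹' {t}).ncard = 3 := by
  obtain ⟨e, rfl⟩ : ∃ e, t = 2 * e := ⟨t / 2, by field_simp [Ring.two_ne_zero h2]⟩
  have he : e ^ 2 = 1 := by
    have h4 : (4 : F) ≠ 0 := by
      rw [show (4 : F) = 2 * 2 by norm_num]
      exact mul_ne_zero (Ring.two_ne_zero h2) (Ring.two_ne_zero h2)
    exact mul_left_cancel₀ h4 (by linear_combination ht)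
  obtain ⟨r', hr'⟩ := FiniteField.exists_nonsquare h2
  obtain ⟨r, rfl⟩ : IsUnit r' := isUnit_iff_ne_zero.2 fun h => hr' (h ▸ IsSquare.zero)
  obtain ⟨z, hz, hztrace⟩ := exists_mem_center_trace_eq he
  have hzne (k : Fˣ) : ConjClasses.mk z ≠ ConjClasses.mk (companionSL (2 * e) k) := fun h =>
    companionSL_notMem_center (2 * e) k
      ((ConjClasses.mk_eq_mk_iff_isConj.1 h).eq_of_left_mem_center hz ▸ hz)
  refine Set.ncard_eq_three.2 ⟨ConjClasses.mk z, ConjClasses.mk (companionSL (2 * e) 1),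
    ConjClasses.mk (companionSL (2 * e) r), hzne 1, hzne r, ?_, Set.Subset.antisymm ?_ ?_⟩
  · rw [Ne, ConjClasses.mk_eq_mk_iff_isConj, isConj_companionSL_two_mul_iff_isSquare he,
      Units.val_one, one_mul]
    exact hr'
  · intro C hC
    obtain ⟨g, rfl⟩ := ConjClasses.mk_surjective C
    rw [Set.mem_preimage, Set.mem_singleton_iff, classTrace_mk] at hC
    by_cases hg : g ∈ Subgroup.center SL(2, F)
    · exact .inl (congrArg ConjClasses.mk
        (eq_of_mem_center_of_trace_eq (Ring.two_ne_zero h2) hg hz (hC.trans hztrace.symm)))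
    · obtain ⟨k, hk⟩ := exists_isConj_companionSL hg
      rw [hC] at hk
      exact .inr <| (isConj_companionSL_one_or_of_not_isSquare he hr' k).imp
        (fun h => ConjClasses.mk_eq_mk_iff_isConj.2 (hk.symm.trans h))
        fun h => ConjClasses.mk_eq_mk_iff_isConj.2 (hk.symm.trans h)
  · rintro C (rfl | rfl | rfl)
    exacts [hztrace, trace_companionSL _ _, trace_companionSL _ _]

theorem natCard_conjClasses_SL2 [Finite F] (h2 : ringChar F ≠ 2) :
    Nat.card (ConjClasses SL(2, F)) = Nat.card F + 4 := by
  classical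
  have := Fintype.ofFinite F
  have hfibers := card_preimage_eq_sum_card_image_eq (f := classTrace (R := F))
    (s := univ) fun _ _ => Set.toFinite _
  have hfiber (t : F) : Nat.card {C // classTrace C = t} = 1 + if t ^ 2 = 4 then 2 else 0 := by
    split_ifs with ht
    · exact ncard_classTrace_preimage_of_sq_eq_four h2 ht
    · exact ncard_classTrace_preimage_of_sq_ne_four h2 ht
  rw [coe_univ, Set.preimage_univ, Nat.card_univ] at hfibers
  rw [hfibers, Nat.card_eq_fintype_card (α := F)]
  simp only [hfiber, sum_add_distrib, ← sum_filter, sum_const, card_sq_eq_four h2, card_univ,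
    smul_eq_mul, mul_one]

theorem compl_cubeClasses_SL2 [Fintype F] [DecidableEq F] (h3 : (3 : F) ≠ 0) :
    (cubeClasses SL(2, F))ᶜ = classTrace ⁻¹' noncubeTraces F := by
  ext C
  obtain ⟨g, rfl⟩ := ConjClasses.mk_surjective C
  rw [Set.mem_compl_iff, mk_mem_cubeClasses_iff, mem_cubeSet_iff_trace h3, Set.mem_preimage,
    classTrace_mk, mem_coe, mem_noncubeTraces, not_exists]

theorem ncard_compl_cubeClasses_SL2 [Fintype F] [DecidableEq F] (h2 : ringChar F ≠ 2)
    (h3 : (3 : F) ≠ 0) : (cubeClasses SL(2, F))ᶜ.ncard = #(noncubeTraces F) := by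
  have hfiber : ∀ t ∈ noncubeTraces F, Nat.card {C // classTrace C = t} = 1 := fun t ht =>
    ncard_classTrace_preimage_of_sq_ne_four h2 fun h =>
      not_exists.2 (mem_noncubeTraces.1 ht) (exists_traceCube_eq_of_sq_eq_four h)
  rw [compl_cubeClasses_SL2 h3, ← Nat.card_coe_set_eq,
    card_preimage_eq_sum_card_image_eq fun _ _ => Set.toFinite _, sum_const_nat hfiber, mul_one]

theorem three_mul_ncard_cubeClasses_SL2 [Finite F] (h2 : ringChar F ≠ 2) (h3 : (3 : F) ≠ 0) :
    3 * ((cubeClasses SL(2, F)).ncard : ℤ) =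
      2 * Nat.card F + 12 + quadraticChar (ZMod 3) (Nat.card F) := by
  classical
  have := Fintype.ofFinite F
  have hsplit := Set.ncard_add_ncard_compl (cubeClasses SL(2, F))
  have hnoncubes := three_mul_card_noncubeTraces h2 h3
  rw [ncard_compl_cubeClasses_SL2 h2 h3, natCard_conjClasses_SL2 h2] at hsplit
  rw [quadraticChar_neg_three h2 h3, ← Nat.card_eq_fintype_card] at hnoncubes
  lia

theorem abs_cubeClasses_proportion_sub_lt [Finite F] (h2 : ringChar F ≠ 2) (h3 : (3 : F) ≠ 0) :
    |((cubeClasses SL(2, F)).ncard : ℝ) / Nat.card (ConjClasses SL(2, F)) - 2 / 3| <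
      2 / Nat.card F := by
  have hc := three_mul_ncard_cubeClasses_SL2 h2 h3
  have hq : (0 : ℝ) < Nat.card F := by exact_mod_cast Nat.card_pos
  rw [natCard_conjClasses_SL2 h2, Nat.cast_add, Nat.cast_ofNat]
  set c := (cubeClasses SL(2, F)).ncard
  set q := Nat.card F
  obtain ⟨hlow, hhigh⟩ : (8 + 2 * q : ℝ) ≤ 3 * c ∧ (3 * c : ℝ) ≤ 2 * q + 13 := by
    norm_cast
    rcases quadraticChar_isQuadratic (ZMod 3) (q : ZMod 3) with h | h | h <;> rw [h] at hc <;> lia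
  have hdiff : (c : ℝ) / (q + 4) - 2 / 3 = (3 * c - (8 + 2 * q)) / (3 * (q + 4)) := by
    field_simp
    ring
  rw [hdiff, abs_of_nonneg (div_nonneg (sub_nonneg.2 hlow) (by positivity)),
    div_lt_div_iff₀ (by positivity) hq]
  nlinarith

end Classes

theorem proposition6p3 :
    (∀ (F : Type*) [Field F] [Finite F] (q : ℕ), Nat.card F = q → ¬ 2 ∣ q → ¬ 3 ∣ q →
      (3 ∣ q - 1 →
        ((cubeClasses (Matrix.SpecialLinearGroup (Fin 2) F)).ncard : ℚ) = (2 * q + 13) / 3) ∧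
      (3 ∣ q + 1 →
        ((cubeClasses (Matrix.SpecialLinearGroup (Fin 2) F)).ncard : ℚ) = (2 * q + 11) / 3) ∧
      ((cubeSet (Matrix.SpecialLinearGroup (Fin 2) F)).ncard : ℚ) =
        2 * q * ((q : ℚ) ^ 2 - 1) / 3 ∧
      ((cubeSet (Matrix.SpecialLinearGroup (Fin 2) F)).ncard : ℚ) /
        (Nat.card (Matrix.SpecialLinearGroup (Fin 2) F) : ℚ) = 2 / 3) ∧
    (∀ ε : ℝ, 0 < ε → ∃ N : ℕ, ∀ (F : Type*) [Field F] [Finite F] (q : ℕ), Nat.card F = q →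
      ¬ 2 ∣ q → ¬ 3 ∣ q → N ≤ q →
      |((cubeClasses (Matrix.SpecialLinearGroup (Fin 2) F)).ncard : ℝ) /
        (Nat.card (ConjClasses (Matrix.SpecialLinearGroup (Fin 2) F)) : ℝ) - 2 / 3| < ε) := by
  refine ⟨?_, fun ε hε => ?_⟩
  · rintro F _ _ _ rfl hq2 hq3
    have h2 := ringChar_ne_two_of_not_two_dvd_card hq2
    have h3 := three_ne_zero_of_not_three_dvd_card hq3
    have hc : 3 * ((cubeClasses SL(2, F)).ncard : ℚ) =
        2 * Nat.card F + 12 + quadraticChar (ZMod 3) (Nat.card F) := by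
      exact_mod_cast three_mul_ncard_cubeClasses_SL2 h2 h3
    have hs : 3 * ((cubeSet SL(2, F)).ncard : ℚ) = 2 * Nat.card SL(2, F) := by
      exact_mod_cast three_mul_ncard_cubeSet_SL2 h2 h3
    have hG : (Nat.card SL(2, F) : ℚ) = Nat.card F * ((Nat.card F : ℚ) ^ 2 - 1) := by
      exact_mod_cast natCard_SL2 h2
    refine ⟨fun h => ?_, fun h => ?_, by linear_combination (hs + 2 * hG) / 3, ?_⟩
    · rw [quadraticChar_three_eq_one Nat.card_pos.ne' h, Int.cast_one] at hc
      linear_combination hc / 3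
    · rw [quadraticChar_three_eq_neg_one h, Int.cast_neg, Int.cast_one] at hc
      linear_combination hc / 3
    · have : (Nat.card SL(2, F) : ℚ) ≠ 0 := Nat.cast_ne_zero.2 Nat.card_pos.ne'
      field_simp
      linear_combination hs
  · obtain ⟨N, hN⟩ := exists_nat_gt (2 / ε)
    refine ⟨N, ?_⟩
    rintro F _ _ _ rfl hq2 hq3 hqN
    have h2 := ringChar_ne_two_of_not_two_dvd_card hq2
    have h3 := three_ne_zero_of_not_three_dvd_card hq3
    have hpos : (0 : ℝ) < Nat.card F := Nat.cast_pos.2 Nat.card_pos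
    refine (abs_cubeClasses_proportion_sub_lt h2 h3).trans ?_
    rw [div_lt_comm₀ hpos hε]
    exact hN.trans_le (Nat.cast_le.2 hqN)
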